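/- A binary $[n,n-r]_2R$ code is a linear subspace $C\subseteq\mathbb F_2^{\,n}$ of dimension $n-r$ whose covering radius, i.e. the smallest integer $\rho$ such that every vector of $\mathbb F_2^{\,n}$ is within Hamming distance $\rho$ of some codeword of $C$, is equal to $R$. The length function $\ell_2(r,R)$ is the smallest $n$ for which an $[n,n-r]_2R$ code exists. Below, $u(r,R)$ denotes the previously known upper bound on $\ell_2(r,R)$, with the explicit value stated, and $\Delta(r,R)=u(r,R)-n$ is the decrease of this bound that is provided by the new code. Theorem. In each of the following cases $n$ is an integer, there is an $[n,n-r]_2R$ code, hence $\ell_2(r,R)\le n$, and $\Delta(r,R)$ has the stated value. 1. $R=2$, $r\in\{22,24,26\}$: $n=26.5\cdot 2^{r/2-4}-3$; here $u(r,2)=27\cdot 2^{r/2-4}-1$ and $\Delta(r,2)=2^{r/2-5}+2$. 2. $R=3$, $r\in\{38,41\}$: $n=820\cdot 2^{(r-26)/3}-2$; here $u(38,3)=822\cdot 2^{(38-26)/3}-2$, $u(41,3)=821\cdot 2^{(41-26)/3}-1$ and $\Delta(r,3)=2^5+\lfloor r/41\rfloor$. 3. $R=3$, $r=21$: $n=303$;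 here $u(21,3)=308$ and $\Delta(21,3)=5$. 4. $R=4$, $r\in\{48,52,56,60,64\}$: $n=2944\cdot 2^{r/4-10}-3$; here $u(r,4)=2944\cdot 2^{r/4-10}-2$ and $\Delta(r,4)=1$. 5. $R=4$, $r=31$: $n=690$; here $u(31,4)=701$ and $\Delta(31,4)=11$. -/

import Mathlib

/-- `R` is the covering radius of the linear code `C ⊆ Fⁿ`: the smallest integer such that the
Hamming balls of radius `R` centred at the codewords of `C` cover `Fⁿ`. -/
def HasCoveringRadius {F : Type*} [Field F] [DecidableEq F] {n : ℕ}
    (C : Submodule F (Fin n → F)) (R : ℕ) : Prop :=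
  IsLeast {ρ : ℕ | ∀ v : Fin n → F, ∃ c ∈ C, hammingDist v c ≤ ρ} R

/-- `C` is an `[n, n - r]R` code over `F`: a linear code of length `n` and codimension `r`
(so its dimension is `n - r`, and in particular `r ≤ n`) with covering radius `R`. -/
def IsCoveringCode {F : Type*} [Field F] [DecidableEq F] {n : ℕ}
    (C : Submodule F (Fin n → F)) (r R : ℕ) : Prop :=
  Module.finrank F C + r = n ∧ HasCoveringRadius C R

/-- The length function `ℓ_q(r, R)`, where `q = |F|`: the smallest length of a linear code over `F`
with codimension `r` and covering radius `R`. -/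
noncomputable def lengthFunction (F : Type*) [Field F] [DecidableEq F] (r R : ℕ) : ℕ :=
  sInf {n : ℕ | ∃ C : Submodule F (Fin n → F), IsCoveringCode C r R}

/-- There is a binary `[n, n - r]R` code, so that `ℓ_2(r, R) ≤ n`, and this lowers the previously
known upper bound `u` on `ℓ_2(r, R)` by exactly `Δ`. The numbers `n`, `u`, `Δ` are rational because
they are given by closed formulas; that `n` is a natural number is part of the assertion. -/
def NewBinaryCode (R r : ℕ) (n u Δ : ℚ) : Prop :=
  ∃ N : ℕ, (N : ℚ) = n ∧
    (∃ C : Submodule (ZMod 2) (Fin N → ZMod 2), IsCoveringCode C r R) ∧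
    lengthFunction (ZMod 2) r R ≤ N ∧ u - n = Δ

/-! In terms of parity-check columns, a code of codimension `r` has covering radius at most `R` as
soon as every syndrome in `𝔽₂^r` is a sum of at most `R` columns. The radius cannot be smaller when
`(N + 1) ^ (R - 1) < 2 ^ r`, by counting sums (`SumCover.exists_isCoveringCode`). So it suffices to
produce short families satisfying `SumCover`.

These come from concatenation. The columns `h i` of a small code are sorted into groups, each group
is given a point of the moment curve or of a conic over a field `K` of characteristic two, and `h i`
is replaced by the `|K|` columns `(h i, ξ • v i)`. If `s` is a sum of `R` columns from distinct
groups, the corresponding points form a basis of `K^R`, and the scalars `ξ` can be chosen to reach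
every `(s, x)`. If `s` needs fewer columns, a few further columns `(0, e)` make up for the missing
dimensions: multiples of a unit vector (`sumCover_extendedFamily`), multiples of the nucleus of the
conic (`sumCover_conic`), or a unit vector's multiples together with a whole code of radius 2
(`sumCover_three`).

What remains is a finite check on five small codes, done by evaluating `coversAll`, where a set of
syndromes is one natural number with `2 ^ r` bits. -/

/-- Every vector is a sum of at most `R` members of the family `f`. -/
def SumCover {ι W : Type*} [AddCommMonoid W] (R : ℕ) (f : ι → W) : Prop :=
  ∀ w, ∃ l : List ι, l.length ≤ R ∧ (l.map f).sum = w

/-! ### Covering families of syndromes and codes -/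

theorem hammingNorm_add_le {ι : Type*} [Fintype ι] {A : Type*} [AddGroup A] [DecidableEq A]
    (x y : ι → A) : hammingNorm (x + y) ≤ hammingNorm x + hammingNorm y := by
  have h := hammingDist_triangle (-x) 0 y
  simpa [hammingDist_eq_hammingNorm] using h

theorem hammingNorm_sum_single_le {ι κ : Type*} [Fintype ι] [DecidableEq ι] (e : κ → ι)
    (l : List κ) :
    hammingNorm (l.map fun k => (Pi.single (e k) 1 : ι → ZMod 2)).sum ≤ l.length := by
  induction l with
  | nil => simp
  | cons a l ih =>
    have h1 : hammingNorm (Pi.single (e a) 1 : ι → ZMod 2) ≤ 1 := by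
      unfold hammingNorm
      refine Finset.card_le_one.2 fun i hi j hj => ?_
      have key : ∀ i ∈ ({i | (Pi.single (e a) 1 : ι → ZMod 2) i ≠ 0} : Finset ι), i = e a := by
        intro i hi
        by_contra hne
        simp [Pi.single_eq_of_ne hne] at hi
      rw [key i hi, key j hj]
    have h2 := hammingNorm_add_le (Pi.single (e a) 1 : ι → ZMod 2)
      (l.map fun k => (Pi.single (e k) 1 : ι → ZMod 2)).sum
    simp only [List.map_cons, List.sum_cons, List.length_cons]
    omega

open scoped Pointwise in
theorem sum_mem_nsmul {ι W : Type*} [AddCommMonoid W] [DecidableEq W] (T : Finset W)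
    (h0 : 0 ∈ T) (g : ι → W) (hg : ∀ i, g i ∈ T) (D : Finset ι) (k : ℕ) (hD : D.card ≤ k) :
    ∑ i ∈ D, g i ∈ k • T := by
  classical
  induction k generalizing D with
  | zero =>
    have : D = ∅ := by simpa using hD
    simp [this]
  | succ k ih =>
    rw [succ_nsmul]
    rcases D.eq_empty_or_nonempty with rfl | ⟨a, ha⟩
    · exact Finset.mem_add.2 ⟨0, by simpa using ih ∅ (by simp), 0, h0, by simp⟩
    · refine Finset.mem_add.2 ⟨_, ih (D.erase a) ?_, g a, hg a, Finset.sum_erase_add D g ha⟩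
      rw [Finset.card_erase_of_mem ha]
      omega

open scoped Pointwise in
theorem SumCover.exists_isCoveringCode {ι W : Type*} [Fintype ι] [AddCommGroup W]
    [Module (ZMod 2) W] [Module.Finite (ZMod 2) W] {f : ι → W} {R r N : ℕ}
    (hf : SumCover R f) (hW : Module.finrank (ZMod 2) W = r) (hN : Fintype.card ι ≤ N)
    (hcard : (N + 1) ^ (R - 1) < 2 ^ r) :
    ∃ C : Submodule (ZMod 2) (Fin N → ZMod 2), IsCoveringCode C r R := by
  classical
  obtain ⟨e⟩ : Nonempty (ι ↪ Fin N) :=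
    Function.Embedding.nonempty_of_card_le (by simpa using hN)
  -- Zero columns pad the family to length exactly `N`; covering is unaffected.
  let g : Fin N → W := Function.extend e f 0
  have hg : ∀ i, g (e i) = f i := fun i => e.injective.extend_apply f 0 i
  let H : (Fin N → ZMod 2) →ₗ[ZMod 2] W := Fintype.linearCombination (ZMod 2) g
  have hH : ∀ v, H v = ∑ i, v i • g i := fun v => Fintype.linearCombination_apply _ _ _
  have hsingle : ∀ l : List ι,
      H (l.map fun k => (Pi.single (e k) 1 : Fin N → ZMod 2)).sum = (l.map f).sum := by
    intro l
    rw [map_list_sum, List.map_map]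
    congr 1
    refine List.map_congr_left fun k _ => ?_
    simp [H, Fintype.linearCombination_apply_single, hg]
  have hsurj : Function.Surjective H := by
    intro w
    obtain ⟨l, -, hl⟩ := hf w
    exact ⟨_, (hsingle l).trans hl⟩
  refine ⟨LinearMap.ker H, ?_, ?_, ?_⟩
  · have h := H.finrank_range_add_finrank_ker
    rw [LinearMap.range_eq_top.2 hsurj, finrank_top, hW, Module.finrank_fin_fun] at h
    omega
  · intro v
    obtain ⟨l, hl, hs⟩ := hf (H v)
    refine ⟨v - (l.map fun k => (Pi.single (e k) 1 : Fin N → ZMod 2)).sum, ?_, ?_⟩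
    · rw [LinearMap.mem_ker, map_sub, hsingle, hs, sub_self]
    · rw [hammingDist_comm, hammingDist_eq_hammingNorm, neg_sub, sub_add_cancel]
      exact (hammingNorm_sum_single_le e l).trans hl
  -- A radius below `R` would put all `2 ^ r` syndromes into the `(R - 1)`-fold sumset of the
  -- columns and `0`, which has at most `(N + 1) ^ (R - 1)` elements.
  · intro ρ hρ
    by_contra hlt
    have hρR : ρ ≤ R - 1 := by omega
    have : Finite W := Module.finite_of_finite (ZMod 2)
    have : Fintype W := Fintype.ofFinite W
    let T : Finset W := insert 0 (Finset.univ.image g)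
    have hT : T.card ≤ N + 1 := by
      refine (Finset.card_insert_le _ _).trans (Nat.succ_le_succ ?_)
      exact Finset.card_image_le.trans (by simp)
    have hall : (Finset.univ : Finset W) ⊆ (R - 1) • T := by
      intro w _
      obtain ⟨v, rfl⟩ := hsurj w
      obtain ⟨c, hc, hd⟩ := hρ v
      have hv : H v = ∑ i ∈ ({i | v i ≠ c i} : Finset (Fin N)), g i := by
        have h1 : H v = H (v - c) := by
          rw [map_sub, LinearMap.mem_ker.1 hc, sub_zero]
        rw [h1, hH, Finset.sum_filter]
        refine Finset.sum_congr rfl fun i _ => ?_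
        by_cases h : v i = c i
        · simp [h]
        · have : (v - c) i = 1 := by
            have h2 : v i - c i ≠ 0 := sub_ne_zero.2 h
            have h3 : ∀ a : ZMod 2, a ≠ 0 → a = 1 := by decide
            exact h3 _ h2
          simp [h, this]
      rw [hv]
      exact sum_mem_nsmul T (Finset.mem_insert_self _ _) g
        (fun i => Finset.mem_insert_of_mem (Finset.mem_image_of_mem g (Finset.mem_univ i))) _ _
        (le_trans hd hρR)
    have h1 : Fintype.card W = 2 ^ r := by
      rw [Module.card_eq_pow_finrank (K := ZMod 2) (V := W), hW, ZMod.card]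
    have h2 := (Finset.card_le_card hall).trans
      (Finset.card_nsmul_le.trans (Nat.pow_le_pow_left hT (R - 1)))
    rw [Finset.card_univ, h1] at h2
    omega

theorem SumCover.newBinaryCode {ι W : Type*} [Fintype ι] [AddCommGroup W]
    [Module (ZMod 2) W] [Module.Finite (ZMod 2) W] {f : ι → W} {R r : ℕ} (N : ℕ) {n u Δ : ℚ}
    (hf : SumCover R f) (hW : Module.finrank (ZMod 2) W = r) (hN : Fintype.card ι ≤ N)
    (hcard : (N + 1) ^ (R - 1) < 2 ^ r) (hn : (N : ℚ) = n) (hΔ : u - n = Δ) :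
    NewBinaryCode R r n u Δ := by
  have h := hf.exists_isCoveringCode hW hN hcard
  exact ⟨N, hn, h, Nat.sInf_le h, hΔ⟩

theorem SumCover.subtype_ne {ι W : Type*} [AddCommMonoid W] {R : ℕ} {f : ι → W}
    (hf : SumCover R f) {a b : ι} (hab : a ≠ b) (h : f a = f b) :
    SumCover R fun i : {i // i ≠ a} => f i := by
  classical
  intro w
  obtain ⟨l, hl, hs⟩ := hf w
  refine ⟨l.map fun i => if hi : i = a then ⟨b, hab.symm⟩ else ⟨i, hi⟩, by simpa using hl, ?_⟩
  rw [List.map_map, ← hs]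
  congr 1
  refine List.map_congr_left fun i _ => ?_
  by_cases hi : i = a <;> simp [hi, h]

theorem SumCover.linearEquiv_comp {ι W W' F : Type*} [AddCommMonoid W] [AddCommMonoid W']
    [EquivLike F W W'] [AddEquivClass F W W'] {R : ℕ} {f : ι → W} (hf : SumCover R f) (e : F) :
    SumCover R fun i => e (f i) := by
  intro w
  obtain ⟨l, hl, hs⟩ := hf (EquivLike.inv e w)
  refine ⟨l, hl, ?_⟩
  have h := map_list_sum e (l.map f)
  rw [hs, List.map_map] at h
  simpa [Function.comp_def] using h.symm

/-! ### Syndrome sets as bit masks -/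

/-- Sets of natural numbers are coded as the positions of the nonzero bits of a natural number.
The mask of the numbers below `2 ^ (i + 1 + k)` whose `i`-th bit vanishes. -/
def clearMask (i : ℕ) : ℕ → ℕ
  | 0 => 2 ^ 2 ^ i - 1
  | k + 1 => clearMask i k ||| (clearMask i k <<< 2 ^ (i + 1 + k))

/-- Image of the set `S` under flipping the `i`-th bit. -/
def flipBit (m i S : ℕ) : ℕ := ((S >>> 2 ^ i) &&& m) ||| ((S &&& m) <<< 2 ^ i)

/-- Image of the set `S ⊆ [0, 2 ^ r)` under `s ↦ s ^^^ (c % 2 ^ k)`. -/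
def xorTranslate (r : ℕ) : ℕ → ℕ → ℕ → ℕ
  | 0, _, S => S
  | k + 1, c, S =>
    bif c.testBit k then flipBit (clearMask k (r - (k + 1))) k (xorTranslate r k c S)
    else xorTranslate r k c S

/-- From the sets of `k`-fold sums (for `k = 0, 1, …`) to the sets of `k`-fold sums that may
use one element of `g` in addition. -/
def stepGroup (r : ℕ) (g : List ℕ) (st : List ℕ) : List ℕ :=
  g.foldl (fun acc c => acc.zipWith Nat.lor (0 :: st.map (xorTranslate r r c))) st

/-- The sets of sums of `k` elements from distinct groups of `L`, for `k = 0, …, R`. -/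
def transversalSums (r R : ℕ) : List (List ℕ) → List ℕ
  | [] => 1 :: List.replicate R 0
  | g :: L => stepGroup r g (transversalSums r R L)

/-- The elements of the groups of `L`, each with a label that names its group. -/
def labelled : List (List ℕ) → List (ℕ × ℕ)
  | [] => []
  | g :: L => g.map (fun c => (L.length, c)) ++ labelled L

/-- `s` is the sum in `𝔽₂^r` of `k` elements of distinct groups of `L`. -/
def IsTransversalSum (L : List (List ℕ)) (k s : ℕ) : Prop :=
  ∃ l : List (ℕ × ℕ), l.length = k ∧ (l.map Prod.fst).Nodup ∧ (∀ p ∈ l, p ∈ labelled L) ∧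
    (l.map Prod.snd).foldr Nat.xor 0 = s

/-- Only soundness matters for the set operations: each bit that is set must come from a genuine
sum. That no sum is missed is never proved, since the evaluation itself shows that all bits are set.
-/
theorem testBit_of_testBit_clearMask {i k j : ℕ} (h : (clearMask i k).testBit j = true) :
    j.testBit i = false := by
  induction k generalizing j with
  | zero =>
    rw [clearMask, Nat.testBit_two_pow_sub_one, decide_eq_true_eq] at h
    exact Nat.testBit_lt_two_pow h
  | succ k ih =>
    rw [clearMask, Nat.testBit_or, Bool.or_eq_true, Nat.testBit_shiftLeft, Bool.and_eq_true,
      decide_eq_true_eq] at h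
    rcases h with h | ⟨hle, h⟩
    · exact ih h
    · obtain ⟨j', rfl⟩ := Nat.exists_eq_add_of_le hle
      rw [Nat.add_sub_cancel_left] at h
      rw [Nat.testBit_two_pow_add_gt (by omega)]
      exact ih h

theorem xor_two_pow_of_testBit_eq_false {i j : ℕ} (h : j.testBit i = false) :
    j ^^^ 2 ^ i = j + 2 ^ i := by
  refine Nat.eq_of_testBit_eq fun k => ?_
  rw [Nat.testBit_xor, Nat.testBit_two_pow, Nat.add_comm]
  rcases lt_trichotomy k i with hk | rfl | hk
  · rw [Nat.testBit_two_pow_add_gt hk]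
    simp [hk.ne']
  · rw [Nat.testBit_two_pow_add_eq, h]
    simp
  · obtain ⟨n, rfl⟩ := Nat.exists_eq_add_of_lt hk
    have h1 : (2 ^ i + j) / 2 ^ i = j / 2 ^ i + 1 := Nat.add_div_left _ (by positivity)
    have h2 : j / 2 ^ i % 2 = 0 := by
      rw [Nat.testBit_eq_decide_div_mod_eq, decide_eq_false_iff_not] at h
      omega
    have h3 : ∀ x : ℕ, x.testBit (i + n + 1) = (x / 2 ^ i / 2).testBit n := by
      intro x
      rw [Nat.add_assoc, Nat.add_comm, Nat.testBit_add, Nat.testBit_add_one]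
    have h4 : (j / 2 ^ i + 1) / 2 = j / 2 ^ i / 2 := by omega
    rw [h3, h3 (2 ^ i + j), h1, h4]
    simp [(show i ≠ i + n + 1 by omega)]

theorem testBit_of_testBit_flipBit {m i S j : ℕ}
    (hm : ∀ j, m.testBit j = true → j.testBit i = false)
    (h : (flipBit m i S).testBit j = true) : S.testBit (j ^^^ 2 ^ i) = true := by
  rw [flipBit, Nat.testBit_or, Bool.or_eq_true, Nat.testBit_and, Bool.and_eq_true,
    Nat.testBit_shiftRight, Nat.testBit_shiftLeft, Bool.and_eq_true, decide_eq_true_eq,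
    Nat.testBit_and, Bool.and_eq_true] at h
  rcases h with ⟨h1, h2⟩ | ⟨hle, h1, h2⟩
  · rwa [xor_two_pow_of_testBit_eq_false (hm _ h2), Nat.add_comm]
  · obtain ⟨j', rfl⟩ := Nat.exists_eq_add_of_le hle
    rw [Nat.add_sub_cancel_left] at h1 h2
    rwa [Nat.add_comm, ← xor_two_pow_of_testBit_eq_false (hm _ h2), Nat.xor_assoc, Nat.xor_self,
      Nat.xor_zero]

theorem mod_two_pow_succ_eq_xor (c k : ℕ) :
    c % 2 ^ (k + 1) = bif c.testBit k then 2 ^ k ^^^ (c % 2 ^ k) else c % 2 ^ k := by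
  refine Nat.eq_of_testBit_eq fun j => ?_
  rw [Nat.testBit_mod_two_pow]
  rcases lt_trichotomy j k with hj | rfl | hj
  · have h1 : ¬ k = j := by omega
    have h2 : j < k + 1 := by omega
    cases c.testBit k <;> simp [Nat.testBit_mod_two_pow, hj, h1, h2]
  · cases h : c.testBit j <;> simp [Nat.testBit_mod_two_pow]
  · have h1 : ¬ k = j := by omega
    have h2 : ¬ j < k + 1 := by omega
    have h3 : ¬ j < k := by omega
    cases c.testBit k <;> simp [Nat.testBit_mod_two_pow, h1, h2, h3]

theorem testBit_of_testBit_xorTranslate {r k c S s : ℕ}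
    (h : (xorTranslate r k c S).testBit s = true) : S.testBit (s ^^^ (c % 2 ^ k)) = true := by
  induction k generalizing s with
  | zero => simpa [xorTranslate, Nat.mod_one] using h
  | succ k ih =>
    rw [mod_two_pow_succ_eq_xor]
    rw [xorTranslate] at h
    cases hc : c.testBit k with
    | false =>
      rw [hc, cond_false] at h
      exact ih h
    | true =>
      rw [hc, cond_true] at h
      have := ih (testBit_of_testBit_flipBit (fun _ => testBit_of_testBit_clearMask) h)
      rwa [Nat.xor_assoc] at this

theorem fst_lt_of_mem_labelled {L : List (List ℕ)} {p : ℕ × ℕ} (h : p ∈ labelled L) :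
    p.1 < L.length := by
  induction L with
  | nil => simp [labelled] at h
  | cons g L ih =>
    rw [labelled, List.mem_append, List.mem_map] at h
    rcases h with ⟨c, _, rfl⟩ | h
    · simp
    · exact (ih h).trans (by simp)

theorem IsTransversalSum.cons {L : List (List ℕ)} {k s : ℕ} (h : IsTransversalSum L k s)
    (g : List ℕ) : IsTransversalSum (g :: L) k s := by
  obtain ⟨l, h1, h2, h3, h4⟩ := h
  exact ⟨l, h1, h2, fun p hp => List.mem_append_right _ (h3 p hp), h4⟩

theorem IsTransversalSum.cons_mem {L : List (List ℕ)} {k s c : ℕ} {g : List ℕ}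
    (h : IsTransversalSum L k (s ^^^ c)) (hc : c ∈ g) : IsTransversalSum (g :: L) (k + 1) s := by
  obtain ⟨l, h1, h2, h3, h4⟩ := h
  refine ⟨(L.length, c) :: l, by simp [h1], ?_, ?_, ?_⟩
  · rw [List.map_cons, List.nodup_cons]
    refine ⟨fun hmem => ?_, h2⟩
    obtain ⟨p, hp, hpl⟩ := List.mem_map.1 hmem
    have := fst_lt_of_mem_labelled (h3 p hp)
    simp only at hpl
    omega
  · intro p hp
    rcases List.mem_cons.1 hp with rfl | hp
    · exact List.mem_append_left _ (List.mem_map.2 ⟨c, hc, rfl⟩)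
    · exact List.mem_append_right _ (h3 p hp)
  · rw [List.map_cons, List.foldr_cons, h4]
    change c ^^^ (s ^^^ c) = s
    rw [Nat.xor_comm s c, ← Nat.xor_assoc, Nat.xor_self, Nat.zero_xor]

/-- Every translate is taken of the original `st`, not of the accumulator, so a group contributes at
most one element; hence `hstep` speaks of `st` alone. -/
theorem testBit_foldl_stepGroup {r : ℕ} {st : List ℕ} {P : ℕ → ℕ → Prop} (g : List ℕ)
    (hstep : ∀ c ∈ g, ∀ k s, ((st.getD k 0).testBit (s ^^^ (c % 2 ^ r))) = true → P (k + 1) s)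
    (acc : List ℕ) (hacc : ∀ k s, (acc.getD k 0).testBit s = true → P k s) (k s : ℕ)
    (h : ((g.foldl (fun acc c => acc.zipWith Nat.lor (0 :: st.map (xorTranslate r r c)))
      acc).getD k 0).testBit s = true) : P k s := by
  induction g generalizing acc with
  | nil => exact hacc k s h
  | cons c g ih =>
    refine ih (fun c hc => hstep c (List.mem_cons_of_mem _ hc)) _ ?_ h
    intro k s hk
    rw [List.getD_eq_getElem?_getD, List.getElem?_zipWith] at hk
    cases ha : acc[k]? with
    | none => simp [ha] at hk
    | some a =>
      cases hb : (0 :: st.map (xorTranslate r r c))[k]? with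
      | none => simp [ha, hb] at hk
      | some b =>
        rw [ha, hb] at hk
        change (a ||| b).testBit s = true at hk
        rw [Nat.testBit_or, Bool.or_eq_true] at hk
        rcases hk with hk | hk
        · exact hacc k s (by simpa [List.getD_eq_getElem?_getD, ha] using hk)
        · cases k with
          | zero =>
            simp only [List.getElem?_cons_zero, Option.some.injEq] at hb
            simp [← hb] at hk
          | succ k =>
            rw [List.getElem?_cons_succ, List.getElem?_map, Option.map_eq_some_iff] at hb
            obtain ⟨t, ht, rfl⟩ := hb
            refine hstep c List.mem_cons_self k s ?_
            rw [List.getD_eq_getElem?_getD, ht]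
            exact testBit_of_testBit_xorTranslate hk

theorem isTransversalSum_of_testBit {r R : ℕ} {L : List (List ℕ)}
    (hL : ∀ g ∈ L, ∀ c ∈ g, c < 2 ^ r) {k s : ℕ}
    (h : ((transversalSums r R L).getD k 0).testBit s = true) : IsTransversalSum L k s := by
  induction L generalizing k s with
  | nil =>
    rw [transversalSums] at h
    cases k with
    | zero =>
      have : s = 0 := by
        rw [List.getD_cons_zero] at h
        exact Nat.testBit_one_eq_true_iff_self_eq_zero.1 h
      exact ⟨[], rfl, List.nodup_nil, by simp, by simp [this]⟩
    | succ k =>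
      rw [List.getD_cons_succ, List.getD_eq_getElem?_getD, List.getElem?_replicate] at h
      split_ifs at h <;> simp at h
  | cons g L ih =>
    have ih' := @ih (fun g hg => hL g (List.mem_cons_of_mem _ hg))
    refine testBit_foldl_stepGroup (P := IsTransversalSum (g :: L)) g ?_ _ ?_ k s h
    · intro c hc k s hk
      rw [Nat.mod_eq_of_lt (hL g List.mem_cons_self c hc)] at hk
      exact (ih' hk).cons_mem hc
    · intro k s hk
      exact (ih' hk).cons g

/-! ### Columns over `𝔽₂` and the covering check -/

/-- The vector in `𝔽₂^r` of the binary digits of a natural number. -/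
def bitVector (r n : ℕ) : Fin r → ZMod 2 := fun i => if n.testBit i then 1 else 0

theorem bitVector_xor (r a b : ℕ) : bitVector r (a ^^^ b) = bitVector r a + bitVector r b := by
  funext i
  simp only [bitVector, Nat.testBit_xor, Pi.add_apply]
  cases a.testBit i <;> cases b.testBit i <;> decide

theorem bitVector_zero (r : ℕ) : bitVector r 0 = 0 := by
  funext i
  simp [bitVector]

theorem exists_bitVector_eq {r : ℕ} (w : Fin r → ZMod 2) :
    ∃ s < 2 ^ r, bitVector r s = w := by
  refine ⟨Nat.ofBits fun i => w i == 1, Nat.ofBits_lt_two_pow _, ?_⟩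
  funext i
  have : ∀ a : ZMod 2, (if (a == 1) = true then (1 : ZMod 2) else 0) = a := by decide
  rw [bitVector, Nat.testBit_ofBits_lt _ _ i.2]
  exact this _

theorem bitVector_foldr_xor (r : ℕ) (l : List ℕ) :
    bitVector r (l.foldr Nat.xor 0) = (l.map (bitVector r)).sum := by
  induction l with
  | nil => exact bitVector_zero r
  | cons a l ih => rw [List.foldr_cons, List.map_cons, List.sum_cons, ← ih]; exact bitVector_xor r a _

/-- The column with number `i`. -/
def column (r : ℕ) (L : List (List ℕ)) (i : Fin (labelled L).length) : Fin r → ZMod 2 :=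
  bitVector r (labelled L)[i].2

/-- The number of the group of the column with number `i`. -/
def groupOf (L : List (List ℕ)) (i : Fin (labelled L).length) : ℕ := (labelled L)[i].1

theorem groupOf_lt (L : List (List ℕ)) (i : Fin (labelled L).length) : groupOf L i < L.length :=
  fst_lt_of_mem_labelled (List.getElem_mem _)

/-- `w` is the sum of `t` columns from distinct groups. -/
def IsColumnSum (r : ℕ) (L : List (List ℕ)) (t : ℕ) (w : Fin r → ZMod 2) : Prop :=
  ∃ i : Fin t → Fin (labelled L).length, Function.Injective (fun j => groupOf L (i j)) ∧
    ∑ j, column r L (i j) = w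

theorem IsTransversalSum.isColumnSum {L : List (List ℕ)} {k s : ℕ} (h : IsTransversalSum L k s)
    (r : ℕ) : IsColumnSum r L k (bitVector r s) := by
  obtain ⟨l, rfl, h2, h3, rfl⟩ := h
  have h4 : ∀ j : Fin l.length, ∃ i : Fin (labelled L).length, (labelled L)[i] = l[j] := by
    intro j
    obtain ⟨n, hn, h⟩ := List.getElem_of_mem (h3 l[j] (List.getElem_mem _))
    exact ⟨⟨n, hn⟩, h⟩
  choose i hi using h4
  refine ⟨i, ?_, ?_⟩
  · intro a b hab
    simp only [groupOf, hi] at hab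
    have := (List.nodup_iff_injective_get.1 h2) (a₁ := Fin.cast (by simp) a)
      (a₂ := Fin.cast (by simp) b) (by simpa using hab)
    exact Fin.ext (by simpa using congrArg Fin.val this)
  · rw [bitVector_foldr_xor, List.map_map]
    have : l.map (bitVector r ∘ Prod.snd) = List.ofFn fun j => column r L (i j) := by
      refine List.ext_getElem (by simp) fun n h1 h2 => ?_
      simp [column, hi]
    rw [this, List.sum_ofFn]

/-- All elements of `𝔽₂^r` are sums of `t` columns from distinct groups for some `t ∈ ts`. -/
def coversAll (r R : ℕ) (ts : List ℕ) (L : List (List ℕ)) : Bool :=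
  L.all (fun g => g.all fun c => Nat.blt c (2 ^ r)) &&
    Nat.beq (ts.foldr (fun t S => Nat.lor ((transversalSums r R L).getD t 0) S) 0) (2 ^ 2 ^ r - 1)

theorem exists_testBit_of_testBit_foldr_lor {α : Type*} (ts : List α) (F : α → ℕ) (s : ℕ)
    (h : (ts.foldr (fun t S => Nat.lor (F t) S) 0).testBit s = true) :
    ∃ t ∈ ts, (F t).testBit s = true := by
  induction ts with
  | nil => simp at h
  | cons t ts ih =>
    rw [List.foldr_cons] at h
    change (F t ||| _).testBit s = true at h
    rw [Nat.testBit_or, Bool.or_eq_true] at h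
    rcases h with h | h
    · exact ⟨t, List.mem_cons_self, h⟩
    · obtain ⟨t', ht', h'⟩ := ih h
      exact ⟨t', List.mem_cons_of_mem _ ht', h'⟩

theorem exists_isColumnSum {r R : ℕ} {ts : List ℕ} {L : List (List ℕ)}
    (h : coversAll r R ts L = true) (w : Fin r → ZMod 2) : ∃ t ∈ ts, IsColumnSum r L t w := by
  rw [coversAll, Bool.and_eq_true, List.all_eq_true] at h
  obtain ⟨hL, h⟩ := h
  have hL' : ∀ g ∈ L, ∀ c ∈ g, c < 2 ^ r := by
    intro g hg c hc
    have := List.all_eq_true.1 (hL g hg) c hc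
    simpa [Nat.blt_eq] using this
  obtain ⟨s, hs, rfl⟩ := exists_bitVector_eq w
  have hs' := Nat.testBit_two_pow_sub_one (2 ^ r) s
  rw [← Nat.eq_of_beq_eq_true h, decide_eq_true hs] at hs'
  obtain ⟨t, ht, h'⟩ := exists_testBit_of_testBit_foldr_lor ts _ s hs'
  exact ⟨t, ht, (isTransversalSum_of_testBit hL' h').isColumnSum r⟩

/-! ### The explicit small codes -/

/-- Columns of a `[52, 42]2` code, one of which is repeated, in 16 groups. -/
def columns52 : List (List ℕ) :=
  [[768, 818], [450, 451, 944, 195], [346, 185, 376, 426, 392, 155], [640, 849, 913, 947],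
    [167, 356, 866, 182], [107, 73, 883], [373, 71, 388, 930], [576], [928, 723], [78, 704],
    [125, 173], [912, 367, 158, 348, 447, 396, 704], [86, 405], [449, 193, 194], [448, 192],
    [737, 754, 787, 801]]

/-- Columns of an `[18, 9]3` code in 17 groups. -/
def columns18 : List (List ℕ) :=
  [[313, 266], [163], [409], [187], [330], [144], [383], [503], [85], [427], [501], [239],
    [102], [369], [60], [7], [176]]

/-- Columns of the `[23, 12]3` Golay code. -/
def columnsGolay : List (List ℕ) :=
  [1, 2, 4, 8, 16, 32, 64, 128, 256, 512, 1024, 1141, 1183, 1355, 1763, 435, 870, 1740, 493,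
    986, 1972, 797, 1594].map fun c => [c]

/-- Columns of a `[20, 9]4` code. -/
def columns20 : List (List ℕ) :=
  [82, 114, 1679, 892, 92, 780, 1440, 1798, 1042, 2029, 1554, 749, 118, 264, 1107, 1762, 15,
    1961, 318, 921].map fun c => [c]

/-- Columns of a `[90, 70]4` code. The first 72 of them arise from the `[9, 1]4` repetition code
and the points of a twisted cubic over `𝔽₈`. -/
def columns90 : List (List ℕ) :=
  [4096, 4097, 4098, 4099, 4100, 4101, 4102, 4103, 8192, 8777, 9362, 9947, 10532, 11117, 11702,
    12287, 16384, 18193, 19682, 19443, 20380, 18573, 17278, 17519, 32768, 35161, 34418, 36651,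
    36028, 34277, 35534, 33687, 65536, 68513, 66522, 67707, 66932, 69333, 67246, 68879, 131072,
    134633, 134986, 131747, 133716, 133053, 132382, 133367, 262144, 265905, 265018, 263563,
    262892, 265309, 264662, 264039, 524288, 525561, 526762, 527699, 526284, 525109, 527974,
    527007, 1044480, 1044992, 1045504, 1046016, 1046528, 1047040, 1047552, 1048064, 14, 2391,
    921, 1515, 1660, 2752, 3877, 418, 3663, 3101, 1286, 2233, 1008, 1876, 3250, 2795,
    1625, 1495].map fun c => [c]

theorem coversAll_columns52 : coversAll 10 2 [2] columns52 = true := by decide +kernel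

theorem coversAll_columns18 : coversAll 9 3 [0, 1, 2, 3] columns18 = true := by decide +kernel

theorem coversAll_columnsGolay : coversAll 11 3 [0, 1, 2, 3] columnsGolay = true := by
  decide +kernel

theorem coversAll_columns20 : coversAll 11 4 [4, 3] columns20 = true := by decide +kernel

theorem coversAll_columns90 : coversAll 20 4 [4, 3] columns90 = true := by decide +kernel

/-! ### Concatenation with a moment curve -/

/-- The columns `(h i, ξ • v i)` of the concatenation of a code with columns `h i`. -/
def blockFamily {ι K V X : Type*} [SMul K X] (h : ι → V) (v : ι → X) (p : ι × K) : V × X :=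
  (h p.1, p.2 • v p.1)

/-- The columns of a concatenation, together with further columns `(0, e k)`. -/
def extendedFamily {ι κ K V X : Type*} [Zero V] [SMul K X] (h : ι → V) (v : ι → X) (e : κ → X) :
    ι × K ⊕ κ → V × X :=
  Sum.elim (blockFamily h v) fun k => (0, e k)

/-- The point with parameter `β` of the moment curve. -/
def powerVector {K : Type*} [Monoid K] (R : ℕ) (β : K) : Fin R → K := fun j => β ^ (j : ℕ)

section Concatenation

variable {ι κ K V X : Type*} [AddCommMonoid V] [Field K] [AddCommGroup X] [Module K X]

theorem exists_list_blockFamily (h : ι → V) (v : ι → X) {t : ℕ} (i : Fin t → ι) (ξ : Fin t → K) :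
    ∃ l : List (ι × K), l.length = t ∧
      (l.map (blockFamily h v)).sum = (∑ j, h (i j), ∑ j, ξ j • v (i j)) := by
  refine ⟨List.ofFn fun j => (i j, ξ j), List.length_ofFn, ?_⟩
  rw [List.map_ofFn, List.sum_ofFn]
  exact Prod.ext (by simp [Prod.fst_sum, blockFamily]) (by simp [Prod.snd_sum, blockFamily])

theorem exists_list_extendedFamily (h : ι → V) (v : ι → X) (e : κ → X) {R : ℕ} {s : V} {x : X}
    {t : ℕ} (i : Fin t → ι) (ξ : Fin t → K) (l : List κ) (hR : t + l.length ≤ R)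
    (hs : ∑ j, h (i j) = s) (hx : ∑ j, ξ j • v (i j) + (l.map e).sum = x) :
    ∃ l : List (ι × K ⊕ κ), l.length ≤ R ∧ (l.map (extendedFamily h v e)).sum = (s, x) := by
  obtain ⟨l₁, h₁, h₂⟩ := exists_list_blockFamily h v i ξ
  refine ⟨l₁.map Sum.inl ++ l.map Sum.inr, by simpa [h₁] using hR, ?_⟩
  have h₃ : (l.map fun k => ((0, e k) : V × X)).sum = (0, (l.map e).sum) := by
    clear hR hx
    induction l with
    | nil => rfl
    | cons k l ih => rw [List.map_cons, List.sum_cons, ih, List.map_cons, List.sum_cons]; simp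
  rw [List.map_append, List.sum_append, List.map_map, List.map_map]
  change (l₁.map (blockFamily h v)).sum + (l.map fun k => ((0, e k) : V × X)).sum = _
  rw [h₂, h₃, ← hs, ← hx]
  simp

theorem exists_list_units_smul (e : X) (y : K) :
    ∃ l : List Kˣ, l.length ≤ 1 ∧ (y = 0 → l.length = 0) ∧
      (l.map fun w : Kˣ => (w : K) • e).sum = y • e := by
  by_cases hy : y = 0
  · exact ⟨[], by simp, by simp, by simp [hy]⟩
  · exact ⟨[Units.mk0 y hy], by simp, fun h => absurd h hy, by simp⟩

theorem exists_sum_smul_eq_of_det_ne_zero {n : ℕ} (M : Fin n → Fin n → K)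
    (hM : (Matrix.of M).det ≠ 0) (x : Fin n → K) : ∃ ξ : Fin n → K, ∑ j, ξ j • M j = x := by
  refine ⟨Matrix.vecMul x (Matrix.of M)⁻¹, ?_⟩
  have h : Matrix.vecMul (Matrix.vecMul x (Matrix.of M)⁻¹) (Matrix.of M) = x := by
    rw [Matrix.vecMul_vecMul, Matrix.nonsing_inv_mul _ (isUnit_iff_ne_zero.2 hM), Matrix.vecMul_one]
  rw [Matrix.vecMul_eq_sum] at h
  exact h

theorem exists_sum_smul_powerVector_eq {t : ℕ} {b : Fin t → K} (hb : Function.Injective b)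
    (x : Fin t → K) : ∃ ξ : Fin t → K, ∑ j, ξ j • powerVector t (b j) = x :=
  exists_sum_smul_eq_of_det_ne_zero _ (Matrix.det_vandermonde_ne_zero_iff.2 hb) x

/-- If every vector is a sum of `R` columns from distinct groups, then so is, after concatenation
with a moment curve of dimension `R`, every vector. -/
theorem sumCover_blockFamily {R : ℕ} {h : ι → V} {b : ι → K}
    (H : ∀ s, ∃ i : Fin R → ι, Function.Injective (b ∘ i) ∧ ∑ j, h (i j) = s) :
    SumCover R (blockFamily (K := K) h fun i => powerVector R (b i)) := by
  rintro ⟨s, x⟩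
  obtain ⟨i, hi, rfl⟩ := H s
  obtain ⟨ξ, rfl⟩ := exists_sum_smul_powerVector_eq hi x
  obtain ⟨l, h1, h2⟩ := exists_list_blockFamily h (fun i => powerVector R (b i)) i ξ
  exact ⟨l, h1.le, h2⟩

/-- If every vector is a sum of `R + 1` or `R` columns from distinct groups, then after
concatenation one needs a Hamming code in addition. -/
theorem sumCover_extendedFamily {R : ℕ} {h : ι → V} {b : ι → K}
    (H : ∀ s, (∃ i : Fin (R + 1) → ι, Function.Injective (b ∘ i) ∧ ∑ j, h (i j) = s) ∨
      ∃ i : Fin R → ι, Function.Injective (b ∘ i) ∧ ∑ j, h (i j) = s) :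
    SumCover (R + 1) (extendedFamily (K := K) h (fun i => powerVector (R + 1) (b i))
      fun w : Kˣ => (w : K) • (Pi.single (Fin.last R) 1 : Fin (R + 1) → K)) := by
  rintro ⟨s, x⟩
  rcases H s with ⟨i, hi, hs⟩ | ⟨i, hi, hs⟩
  · obtain ⟨ξ, hξ⟩ := exists_sum_smul_powerVector_eq hi x
    exact exists_list_extendedFamily _ _ _ i ξ [] le_rfl hs (by simpa using hξ)
  -- With one column fewer, a smaller Vandermonde system settles all coordinates but the last, and
  -- one multiple of the last unit vector repairs that.
  · obtain ⟨ξ, hξ⟩ := exists_sum_smul_powerVector_eq hi fun j => x j.castSucc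
    obtain ⟨l, hl, -, hle⟩ := exists_list_units_smul (Pi.single (Fin.last R) 1 : Fin (R + 1) → K)
      ((x - ∑ j, ξ j • powerVector (R + 1) (b (i j))) (Fin.last R))
    refine exists_list_extendedFamily _ _ _ i ξ l (by omega) hs ?_
    rw [hle]
    funext k
    refine Fin.lastCases ?_ (fun k => ?_) k
    · simp
    · have := congrFun hξ k
      simpa [powerVector] using this

/-- Concatenation of a code of covering radius 3 with columns from distinct groups: one needs a
Hamming code and a code of covering radius 2 in addition. -/
theorem sumCover_three {h : ι → V} {b : ι → K} (hb : ∀ i, b i ≠ 0)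
    (H : ∀ s, ∃ t ≤ 3, ∃ i : Fin t → ι, Function.Injective (b ∘ i) ∧ ∑ j, h (i j) = s)
    {ε : κ → Fin 2 → K} (hε : SumCover 2 ε) :
    SumCover 3 (extendedFamily (K := K) h (fun i => powerVector 3 (b i))
      (Sum.elim (fun w : Kˣ => (w : K) • (![0, 0, 1] : Fin 3 → K))
        fun k => ![ε k 0, ε k 1, 0])) := by
  have hlist : ∀ (y : Fin 2 → K) (z : K), ∃ l : List (Kˣ ⊕ κ), l.length ≤ 3 ∧
      (l.map (Sum.elim (fun w : Kˣ => (w : K) • (![0, 0, 1] : Fin 3 → K))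
        fun k => ![ε k 0, ε k 1, 0])).sum = ![y 0, y 1, z] ∧ (z = 0 → l.length ≤ 2) ∧
        (y = 0 → l.length ≤ 1) := by
    intro y z
    obtain ⟨l₁, h₁, h₁'', h₁'⟩ := exists_list_units_smul (![0, 0, 1] : Fin 3 → K) z
    obtain ⟨l₂, h₂, h₂', h₂''⟩ : ∃ l : List κ, l.length ≤ 2 ∧ (l.map ε).sum = y ∧
        (y = 0 → l.length = 0) := by
      by_cases hy : y = 0
      · exact ⟨[], by simp, by simp [hy], fun _ => rfl⟩
      · obtain ⟨l, hl, hl'⟩ := hε y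
        exact ⟨l, hl, hl', fun h => absurd h hy⟩
    have h₃ : (l₂.map fun k => (![ε k 0, ε k 1, 0] : Fin 3 → K)).sum = ![y 0, y 1, 0] := by
      rw [← h₂']
      clear h₂ h₂' h₂''
      induction l₂ with
      | nil => funext j; fin_cases j <;> simp
      | cons k l ih =>
        rw [List.map_cons, List.sum_cons, ih, List.map_cons, List.sum_cons]
        funext j
        fin_cases j <;> simp
    refine ⟨l₁.map Sum.inl ++ l₂.map Sum.inr, ?_, ?_, ?_, ?_⟩
    · simp only [List.length_append, List.length_map]
      omega
    · rw [List.map_append, List.sum_append, List.map_map, List.map_map, Sum.elim_comp_inl,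
        Sum.elim_comp_inr, h₁', h₃]
      funext j
      fin_cases j <;> simp
    · intro hz
      have := h₁'' hz
      simp only [List.length_append, List.length_map]
      omega
    · intro hy
      have := h₂'' hy
      simp only [List.length_append, List.length_map]
      omega
  rintro ⟨s, x⟩
  obtain ⟨t, ht, i, hi, hs⟩ := H s
  interval_cases t
  · obtain ⟨l, hl, hsum, -, -⟩ := hlist ![x 0, x 1] (x 2)
    refine exists_list_extendedFamily _ _ _ i 0 l (by omega) hs ?_
    rw [hsum]
    funext j
    fin_cases j <;> simp
  -- As the parameter is nonzero, one scalar clears the last coordinate; the two others are left to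
  -- the code of radius 2.
  · have hβ := hb (i 0)
    obtain ⟨l, -, hsum, hl, -⟩ :=
      hlist ![x 0 - x 2 / b (i 0) ^ 2, x 1 - x 2 / b (i 0) ^ 2 * b (i 0)] 0
    refine exists_list_extendedFamily _ _ _ i (fun _ => x 2 / b (i 0) ^ 2) l
      (by have := hl rfl; omega) hs ?_
    rw [hsum]
    funext j
    fin_cases j <;> simp [powerVector, hβ]
  -- Two columns settle the first two coordinates, and one multiple of `(0, 0, 1)` the last.
  · obtain ⟨ξ, hξ⟩ := exists_sum_smul_powerVector_eq hi ![x 0, x 1]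
    obtain ⟨l, -, hsum, -, hl⟩ := hlist 0 (x 2 - ∑ j, ξ j * b (i j) ^ 2)
    refine exists_list_extendedFamily _ _ _ i ξ l (by have := hl rfl; omega) hs ?_
    rw [hsum]
    have h0 := congrFun hξ 0
    have h1 := congrFun hξ 1
    simp only [Fin.sum_univ_two, powerVector, Pi.add_apply, Pi.smul_apply, smul_eq_mul,
      Function.comp_apply] at h0 h1
    funext j
    fin_cases j
    · simpa [powerVector] using h0
    · simpa [powerVector] using h1
    · simp [powerVector]
  · obtain ⟨ξ, hξ⟩ := exists_sum_smul_powerVector_eq hi x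
    exact exists_list_extendedFamily _ _ _ i ξ [] le_rfl hs (by simpa using hξ)

end Concatenation

/-! ### Concatenation with a conic and its nucleus -/

/-- The point with parameter `β` of the conic `x₁² = x₀x₂`. -/
def conicPoint {K : Type*} [Field K] : Option K → Fin 3 → K
  | none => ![0, 0, 1]
  | some β => ![1, β, β ^ 2]

section Conic

variable {ι K V : Type*} [Field K] [AddCommMonoid V]

theorem det_conicPoint_ne_zero {c : Fin 3 → Option K} (hc : Function.Injective c) :
    (Matrix.of fun j => conicPoint (c j)).det ≠ 0 := by
  have h01 : c 0 ≠ c 1 := fun h => absurd (hc h) (by decide)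
  have h02 : c 0 ≠ c 2 := fun h => absurd (hc h) (by decide)
  have h12 : c 1 ≠ c 2 := fun h => absurd (hc h) (by decide)
  have hmul : ∀ {a b d : K}, a ≠ b → a ≠ d → b ≠ d → (b - a) * (d - a) * (d - b) ≠ 0 :=
    fun h₁ h₂ h₃ => mul_ne_zero (mul_ne_zero (sub_ne_zero.2 h₁.symm) (sub_ne_zero.2 h₂.symm))
      (sub_ne_zero.2 h₃.symm)
  rw [Matrix.det_fin_three]
  simp only [Matrix.of_apply]
  rcases h0 : c 0 with _ | a <;> rcases h1 : c 1 with _ | b <;> rcases h2 : c 2 with _ | d <;>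
    simp only [h0, h1, h2, ne_eq, not_true_eq_false, Option.some.injEq] at h01 h02 h12 <;>
    simp only [conicPoint, Matrix.cons_val, mul_zero, zero_mul, mul_one, one_mul, sub_zero,
      zero_sub, add_zero, zero_add, sub_self, ne_eq]
  · exact fun h => h12 (sub_eq_zero.1 (by linear_combination -h))
  · exact fun h => h02 (sub_eq_zero.1 (by linear_combination h))
  · exact fun h => h01 (sub_eq_zero.1 (by linear_combination -h))
  · exact fun h => hmul h01 h02 h12 (by linear_combination h)

/-- In characteristic two, no line through the nucleus `(0, 1, 0)` contains two points of the
conic. -/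
theorem det_conicPoint_nucleus_ne_zero [CharP K 2] {a b : Option K} (hab : a ≠ b) :
    (Matrix.of ![conicPoint a, conicPoint b, ![0, 1, 0]]).det ≠ 0 := by
  rw [Matrix.det_fin_three]
  have h2 : (2 : K) = 0 := CharTwo.two_eq_zero
  rcases a with _ | a <;> rcases b with _ | b
  · exact absurd rfl hab
  · simp [conicPoint]
  · simp [conicPoint]
  · have hab' : a - b ≠ 0 := sub_ne_zero.2 fun h => hab (congrArg some h)
    intro h
    simp [conicPoint] at h
    refine hab' (pow_eq_zero_iff two_ne_zero |>.1 ?_)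
    linear_combination h + (b ^ 2 - a * b) * h2

/-- A line through a point of the conic is either a secant or the tangent there, and in
characteristic two every tangent passes through the nucleus. -/
theorem exists_eq_smul_conicPoint_add_smul [CharP K 2] (a : Option K) (x : Fin 3 → K) :
    (∃ (ξ η : K) (c : Option K), ξ • conicPoint a + η • conicPoint c = x) ∨
      ∃ ξ η : K, ξ • conicPoint a + η • ![0, 1, 0] = x := by
  have h2 : (2 : K) = 0 := CharTwo.two_eq_zero
  rcases a with _ | β
  · by_cases h0 : x 0 = 0
    · refine Or.inr ⟨x 2, x 1, ?_⟩
      funext j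
      fin_cases j <;> simp [conicPoint, h0]
    · refine Or.inl ⟨x 2 - x 0 * (x 1 / x 0) ^ 2, x 0, some (x 1 / x 0), ?_⟩
      funext j
      fin_cases j <;> simp [conicPoint]
      field_simp
  · by_cases h1 : x 1 - β * x 0 = 0
    · refine Or.inl ⟨x 0, x 2 - β ^ 2 * x 0, none, ?_⟩
      funext j
      fin_cases j <;> simp [conicPoint]
      · linear_combination -h1
      · ring
    · by_cases hy : x 2 - β ^ 2 * x 0 = 0
      · refine Or.inr ⟨x 0, x 1 - β * x 0, ?_⟩
        funext j
        fin_cases j <;> simp [conicPoint]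
        · ring
        · linear_combination -hy
      -- For a second point with parameter `t - β` and coefficient `η`, the equations become `η * t
      -- = x 1 - β * x 0` and `η * t ^ 2 = x 2 - β ^ 2 * x 0`, because cross terms carry a factor 2.
      · obtain ⟨η, hη⟩ : ∃ η, η * (x 2 - β ^ 2 * x 0) = (x 1 - β * x 0) ^ 2 :=
          ⟨_, div_mul_cancel₀ _ hy⟩
        obtain ⟨t, ht⟩ : ∃ t, t * (x 1 - β * x 0) = x 2 - β ^ 2 * x 0 :=
          ⟨_, div_mul_cancel₀ _ h1⟩
        have hηt : η * t = x 1 - β * x 0 := by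
          apply mul_right_cancel₀ h1
          linear_combination hη + η * ht
        refine Or.inl ⟨x 0 - η, η, some (t - β), ?_⟩
        funext j
        fin_cases j <;> simp [conicPoint]
        · linear_combination hηt - η * β * h2
        · linear_combination t * hηt + ht - η * t * β * h2

/-- Since every element is a square, each line through the nucleus meets the conic. -/
theorem exists_eq_smul_conicPoint_add_smul_nucleus (hsq : ∀ y : K, IsSquare y) (x : Fin 3 → K) :
    ∃ (ξ η : K) (c : Option K), ξ • conicPoint c + η • ![0, 1, 0] = x := by
  by_cases h0 : x 0 = 0
  · refine ⟨x 2, x 1, none, ?_⟩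
    funext j
    fin_cases j <;> simp [conicPoint, h0]
  · obtain ⟨γ, hγ⟩ := hsq (x 2 / x 0)
    refine ⟨x 0, x 1 - x 0 * γ, some γ, ?_⟩
    rw [div_eq_iff h0] at hγ
    funext j
    fin_cases j <;> simp [conicPoint]
    linear_combination -hγ

/-- Concatenation of a code of covering radius 3 with a conic, in characteristic two: one needs the
multiples of the nucleus in addition. -/
theorem sumCover_conic [CharP K 2] {h : ι → V} {c : ι → Option K} (hV : ∀ v : V, v + v = 0)
    (hsq : ∀ y : K, IsSquare y) (hc : Function.Surjective c)
    (H : ∀ s, ∃ t ≤ 3, ∃ i : Fin t → ι, Function.Injective (c ∘ i) ∧ ∑ j, h (i j) = s) :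
    SumCover 3 (extendedFamily (K := K) h (fun i => conicPoint (c i))
      fun w : Kˣ => (w : K) • (![0, 1, 0] : Fin 3 → K)) := by
  rintro ⟨s, x⟩
  obtain ⟨t, ht, i, hi, hs⟩ := H s
  interval_cases t
  · obtain ⟨ξ, η, a, hx⟩ := exists_eq_smul_conicPoint_add_smul_nucleus hsq x
    obtain ⟨k, rfl⟩ := hc a
    obtain ⟨l, hl, -, hle⟩ := exists_list_units_smul (![0, 1, 0] : Fin 3 → K) η
    -- Taking column `k` twice, with scalars `ξ` and `0`, cancels in `V` and leaves `ξ` times a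
    -- conic point. Surjectivity of `c` makes every conic point available.
    refine exists_list_extendedFamily _ _ _ ![k, k] ![ξ, 0] l (by omega) ?_ ?_
    · simpa [hV] using hs
    · rw [hle]
      simpa using hx
  · rcases exists_eq_smul_conicPoint_add_smul (c (i 0)) x with ⟨ξ, η, a, hx⟩ | ⟨ξ, η, hx⟩
    · obtain ⟨k, rfl⟩ := hc a
      refine exists_list_extendedFamily _ _ _ ![i 0, k, k] ![ξ, η, 0] [] (by simp) ?_ ?_
      · simpa [Fin.sum_univ_three, add_assoc, hV] using hs
      · simpa [Fin.sum_univ_three] using hx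
    · obtain ⟨l, hl, -, hle⟩ := exists_list_units_smul (![0, 1, 0] : Fin 3 → K) η
      refine exists_list_extendedFamily _ _ _ i ![ξ] l (by omega) hs ?_
      rw [hle]
      simpa using hx
  · obtain ⟨ξ, hξ⟩ := exists_sum_smul_eq_of_det_ne_zero _
      (det_conicPoint_nucleus_ne_zero (hi.ne (show (0 : Fin 2) ≠ 1 by decide))) x
    obtain ⟨l, hl, -, hle⟩ := exists_list_units_smul (![0, 1, 0] : Fin 3 → K) (ξ 2)
    refine exists_list_extendedFamily _ _ _ i ![ξ 0, ξ 1] l (by omega) hs ?_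
    rw [hle, ← hξ]
    simp [Fin.sum_univ_three]
  · obtain ⟨ξ, hξ⟩ := exists_sum_smul_eq_of_det_ne_zero _ (det_conicPoint_ne_zero hi) x
    exact exists_list_extendedFamily _ _ _ i ξ [] le_rfl hs (by simpa using hξ)

end Conic

/-! ### Covering families from the small codes -/

theorem IsColumnSum.exists_injective_comp {r t : ℕ} {L : List (List ℕ)} {w : Fin r → ZMod 2}
    (h : IsColumnSum r L t w) {α : Type*} {b : Fin L.length → α} (hb : Function.Injective b) :
    ∃ i : Fin t → Fin (labelled L).length,
      Function.Injective ((fun i => b ⟨groupOf L i, groupOf_lt L i⟩) ∘ i) ∧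
        ∑ j, column r L (i j) = w := by
  obtain ⟨i, hi, hw⟩ := h
  exact ⟨i, fun j k hjk => hi (Fin.mk.inj (hb hjk)), hw⟩

theorem exists_injective_of_le_card {α : Type*} [Fintype α] {n : ℕ} (h : n ≤ Fintype.card α) :
    ∃ b : Fin n → α, Function.Injective b := by
  obtain ⟨b⟩ := Function.Embedding.nonempty_of_card_le (α := Fin n) (β := α) (by simpa using h)
  exact ⟨b, b.injective⟩

theorem finrank_bits_prod (r R : ℕ) (K : Type*) [Field K] [Algebra (ZMod 2) K] [Finite K] :
    Module.finrank (ZMod 2) ((Fin r → ZMod 2) × (Fin R → K)) =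
      r + R * Module.finrank (ZMod 2) K := by
  rw [Module.finrank_prod, Module.finrank_fin_fun, Module.finrank_pi_fintype]
  simp

theorem exists_ne_columns52 : ∃ i j : Fin (labelled columns52).length, i ≠ j ∧
    ((labelled columns52).get i).2 = ((labelled columns52).get j).2 := by
  decide +kernel

section Families

variable (K : Type*) [Field K] [Fintype K]

theorem exists_sumCover_columns52 (hK : 16 ≤ Fintype.card K) :
    ∃ v : Fin (labelled columns52).length → Fin 2 → K,
      SumCover 2 (blockFamily (K := K) (column 10 columns52) v) := by
  obtain ⟨b, hb⟩ := exists_injective_of_le_card hK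
  refine ⟨_, sumCover_blockFamily (b := fun i => b ⟨groupOf columns52 i, groupOf_lt _ i⟩) ?_⟩
  intro s
  obtain ⟨t, ht, h⟩ := exists_isColumnSum coversAll_columns52 s
  obtain rfl := List.mem_singleton.1 ht
  exact h.exists_injective_comp hb

theorem exists_sumCover_columns52_erase [DecidableEq K] (hK : 16 ≤ Fintype.card K) :
    ∃ (v : Fin (labelled columns52).length → Fin 2 → K) (a : Fin (labelled columns52).length × K),
      SumCover 2 fun i : {i // i ≠ a} => blockFamily (K := K) (column 10 columns52) v i := by
  obtain ⟨v, hv⟩ := exists_sumCover_columns52 K hK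
  obtain ⟨i, j, hij, h⟩ := exists_ne_columns52
  -- With scalar `0` the repeated column gives the same vector in both groups, so one copy can be
  -- dropped.
  refine ⟨v, (i, 0), hv.subtype_ne (b := (j, 0)) (by simpa using hij) ?_⟩
  have h' : column 10 columns52 i = column 10 columns52 j := congrArg (bitVector 10) h
  simp only [blockFamily, h', zero_smul]

theorem exists_sumCover_columnsGolay (hK : 24 ≤ Fintype.card K) {κ : Type*} {ε : κ → Fin 2 → K}
    (hε : SumCover 2 ε) :
    ∃ (v : Fin (labelled columnsGolay).length → Fin 3 → K) (e : Kˣ ⊕ κ → Fin 3 → K),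
      SumCover 3 (extendedFamily (K := K) (column 11 columnsGolay) v e) := by
  classical
  -- The 23 parameters must be nonzero for `sumCover_three`, hence the bound 24.
  obtain ⟨b, hb⟩ := exists_injective_of_le_card (α := Kˣ) (n := 23)
    (by rw [Fintype.card_units]; omega)
  refine ⟨_, _, sumCover_three
    (b := fun i => (b ⟨groupOf columnsGolay i, groupOf_lt _ i⟩ : K)) (fun i => (b _).ne_zero)
    ?_ hε⟩
  intro s
  obtain ⟨t, ht, h⟩ := exists_isColumnSum coversAll_columnsGolay s
  refine ⟨t, ?_, h.exists_injective_comp (b := fun k => (b k : K)) (Units.val_injective.comp hb)⟩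
  have : ∀ t ∈ [0, 1, 2, 3], t ≤ 3 := by decide
  exact this t ht

theorem exists_sumCover_columns18 [CharP K 2] (hK : Fintype.card K = 16) :
    ∃ (v : Fin (labelled columns18).length → Fin 3 → K) (e : Kˣ → Fin 3 → K),
      SumCover 3 (extendedFamily (K := K) (column 9 columns18) v e) := by
  classical
  -- The 17 groups match the `16 + 1` points of the conic exactly.
  have b : Fin columns18.length ≃ Option K := Fintype.equivOfCardEq (by
    rw [Fintype.card_option, hK, Fintype.card_fin]; rfl)
  refine ⟨_, _, sumCover_conic (c := fun i => b ⟨groupOf columns18 i, groupOf_lt _ i⟩)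
    (fun v => CharTwo.add_self_eq_zero v)
    (FiniteField.isSquare_of_char_two (ringChar.eq K 2)) ?_ ?_⟩
  · have h : ∀ k : Fin columns18.length, ∃ i, groupOf columns18 i = k := by decide +kernel
    intro a
    obtain ⟨i, hi⟩ := h (b.symm a)
    exact ⟨i, by simp [hi]⟩
  · intro s
    obtain ⟨t, ht, h⟩ := exists_isColumnSum coversAll_columns18 s
    refine ⟨t, ?_, h.exists_injective_comp b.injective⟩
    have : ∀ t ∈ [0, 1, 2, 3], t ≤ 3 := by decide
    exact this t ht

theorem exists_sumCover_of_coversAll {r R : ℕ} {L : List (List ℕ)}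
    (hL : coversAll r (R + 1) [R + 1, R] L = true) (hK : L.length ≤ Fintype.card K) :
    ∃ (v : Fin (labelled L).length → Fin (R + 1) → K) (e : Kˣ → Fin (R + 1) → K),
      SumCover (R + 1) (extendedFamily (K := K) (column r L) v e) := by
  obtain ⟨b, hb⟩ := exists_injective_of_le_card hK
  refine ⟨_, _, sumCover_extendedFamily (b := fun i => b ⟨groupOf L i, groupOf_lt _ i⟩) ?_⟩
  intro s
  obtain ⟨t, ht, h⟩ := exists_isColumnSum hL s
  simp only [List.mem_cons, List.not_mem_nil, or_false] at ht
  obtain rfl | rfl := ht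
  · exact Or.inl (h.exists_injective_comp hb)
  · exact Or.inr (h.exists_injective_comp hb)

end Families

/-! ### The new codes -/

section Codes

variable {m : ℕ} {n u Δ : ℚ}

noncomputable instance (m : ℕ) : Fintype (GaloisField 2 m) := Fintype.ofFinite _

theorem card_galoisField_two (hm : m ≠ 0) : Fintype.card (GaloisField 2 m) = 2 ^ m := by
  rw [← Nat.card_eq_fintype_card, GaloisField.card 2 m hm]

theorem newBinaryCode_two (hm : 4 ≤ m) (hn : ((53 * 2 ^ m - 3 : ℕ) : ℚ) = n) (hΔ : u - n = Δ) :
    NewBinaryCode 2 (10 + 2 * m) n u Δ := by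
  have hK := card_galoisField_two (m := m) (by omega)
  have h16 : 2 ^ 4 ≤ 2 ^ m := Nat.pow_le_pow_right two_pos hm
  obtain ⟨v, hv⟩ := exists_sumCover_columns52 (GaloisField 2 m) (by omega)
  refine hv.newBinaryCode _ ?_ ?_ ?_ hn hΔ
  · rw [finrank_bits_prod, GaloisField.finrank 2 (by omega)]
  -- The family has only `52 * 2 ^ m` columns; padding does the rest.
  · rw [Fintype.card_prod, Fintype.card_fin, hK, show (labelled columns52).length = 52 from rfl]
    omega
  · rw [pow_add, mul_comm 2 m, pow_mul]
    norm_num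
    nlinarith [Nat.sub_le (53 * 2 ^ m) 3]

theorem newBinaryCode_three (hm : 4 ≤ m) (hn : ((820 * 2 ^ m - 2 : ℕ) : ℚ) = n)
    (hΔ : u - n = Δ) : NewBinaryCode 3 (26 + 3 * m) n u Δ := by
  classical
  have hK := card_galoisField_two (m := m) (by omega)
  have hK' := card_galoisField_two (m := m + 5) (by omega)
  rw [pow_add] at hK'
  have h16 : 2 ^ 4 ≤ 2 ^ m := Nat.pow_le_pow_right two_pos hm
  have hfin := GaloisField.finrank 2 (n := m) (by omega)
  have hfin' := GaloisField.finrank 2 (n := m + 5) (by omega)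
  obtain ⟨v, a, hv⟩ := exists_sumCover_columns52_erase (GaloisField 2 m) (by omega)
  -- The exponent `m + 5` is chosen so that `10 + 2 * m = 2 * (m + 5)`: the code of radius 2 then
  -- fills a plane over the larger field.
  have φ : ((Fin 10 → ZMod 2) × (Fin 2 → GaloisField 2 m)) ≃ₗ[ZMod 2]
      (Fin 2 → GaloisField 2 (m + 5)) := LinearEquiv.ofFinrankEq _ _ (by
    rw [finrank_bits_prod, Module.finrank_pi_fintype, hfin]
    simp only [hfin', Finset.sum_const, Finset.card_univ, Fintype.card_fin, smul_eq_mul]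
    ring)
  obtain ⟨v', e, hv'⟩ := exists_sumCover_columnsGolay (GaloisField 2 (m + 5)) (by omega)
    (hv.linearEquiv_comp φ)
  refine hv'.newBinaryCode _ ?_ ?_ ?_ hn hΔ
  · rw [finrank_bits_prod, hfin']
    ring
  · have herase : Fintype.card {i // i ≠ a} = 52 * 2 ^ m - 1 := by
      rw [Fintype.card_subtype_compl, Fintype.card_subtype_eq, Fintype.card_prod,
        Fintype.card_fin, hK]
      rfl
    -- The count is `23 * 32 + 32 + 52 = 820` times `2 ^ m`, less one for the zero multiple and one
    -- for the erased column.
    rw [Fintype.card_sum, Fintype.card_prod, Fintype.card_sum, Fintype.card_fin, Fintype.card_units,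
      hK', herase, show (labelled columnsGolay).length = 23 from rfl]
    omega
  · have h : 820 * 2 ^ m - 2 + 1 ≤ 820 * 2 ^ m := by omega
    refine (Nat.pow_le_pow_left h 2).trans_lt ?_
    rw [pow_add, mul_comm 3 m, pow_mul, mul_pow, pow_succ _ 2]
    have := Nat.pos_of_ne_zero (pow_ne_zero 2 (pow_ne_zero m (two_ne_zero (α := ℕ))))
    nlinarith

theorem newBinaryCode_three_twentyOne : NewBinaryCode 3 21 303 308 5 := by
  have hK := card_galoisField_two (m := 4) (by norm_num)
  obtain ⟨v, e, hv⟩ := exists_sumCover_columns18 (GaloisField 2 4) hK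
  classical
  refine hv.newBinaryCode 303 ?_ ?_ (by norm_num) (by norm_num) (by norm_num)
  · rw [finrank_bits_prod, GaloisField.finrank 2 (by norm_num)]
  · rw [Fintype.card_sum, Fintype.card_prod, Fintype.card_fin, Fintype.card_units, hK,
      show (labelled columns18).length = 18 from rfl]
    norm_num

theorem newBinaryCode_four (hm : 7 ≤ m) (hn : ((92 * 2 ^ m - 3 : ℕ) : ℚ) = n)
    (hΔ : u - n = Δ) : NewBinaryCode 4 (20 + 4 * m) n u Δ := by
  have hK := card_galoisField_two (m := m) (by omega)
  have h128 : 2 ^ 7 ≤ 2 ^ m := Nat.pow_le_pow_right two_pos hm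
  obtain ⟨v, e, hv⟩ := exists_sumCover_of_coversAll (GaloisField 2 m) coversAll_columns90
    (by rw [show columns90.length = 90 from rfl]; omega)
  classical
  refine hv.newBinaryCode _ ?_ ?_ ?_ hn hΔ
  · rw [finrank_bits_prod, GaloisField.finrank 2 (by omega)]
  -- The family has `91 * 2 ^ m - 1` columns, within the claimed length.
  · rw [Fintype.card_sum, Fintype.card_prod, Fintype.card_fin, Fintype.card_units, hK,
      show (labelled columns90).length = 90 from rfl]
    omega
  · have h : 92 * 2 ^ m - 3 + 1 ≤ 92 * 2 ^ m := by omega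
    refine (Nat.pow_le_pow_left h 3).trans_lt ?_
    rw [pow_add, mul_comm 4 m, pow_mul, mul_pow, pow_succ _ 3]
    have := Nat.pos_of_ne_zero (pow_ne_zero 3 (pow_ne_zero m (two_ne_zero (α := ℕ))))
    nlinarith

theorem newBinaryCode_four_thirtyOne : NewBinaryCode 4 31 690 701 11 := by
  have hK := card_galoisField_two (m := 5) (by norm_num)
  obtain ⟨v, e, hv⟩ := exists_sumCover_of_coversAll (GaloisField 2 5) coversAll_columns20
    (by rw [show columns20.length = 20 from rfl, hK]; norm_num)
  classical
  refine hv.newBinaryCode 690 ?_ ?_ (by norm_num) (by norm_num) (by norm_num)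
  · rw [finrank_bits_prod, GaloisField.finrank 2 (by norm_num)]
  -- Here `20 * 32 + 31 = 671` columns suffice; the others are zero.
  · rw [Fintype.card_sum, Fintype.card_prod, Fintype.card_fin, Fintype.card_units, hK,
      show (labelled columns20).length = 20 from rfl]
    norm_num

end Codes

/-- In every `NewBinaryCode R r n u Δ` below, `u` is the previously known upper bound on
`ℓ_2(r, R)`. All divisions in exponents are exact for the listed `r`; `r / 41` is a floor. -/
theorem theorem2p2 :
    (∀ r ∈ ({22, 24, 26} : Finset ℕ),
      NewBinaryCode 2 r (26.5 * 2 ^ (r / 2 - 4) - 3)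
        (27 * 2 ^ (r / 2 - 4) - 1)
        (2 ^ (r / 2 - 5) + 2)) ∧
    (∀ r ∈ ({38, 41} : Finset ℕ),
      NewBinaryCode 3 r (820 * 2 ^ ((r - 26) / 3) - 2)
        (if r = 38 then 822 * 2 ^ ((r - 26) / 3) - 2 else 821 * 2 ^ ((r - 26) / 3) - 1)
        (2 ^ 5 + ((r / 41 : ℕ) : ℚ))) ∧
    NewBinaryCode 3 21 303 308 5 ∧
    (∀ r ∈ ({48, 52, 56, 60, 64} : Finset ℕ),
      NewBinaryCode 4 r (2944 * 2 ^ (r / 4 - 10) - 3)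
        (2944 * 2 ^ (r / 4 - 10) - 2)
        1) ∧
    NewBinaryCode 4 31 690 701 11 := by
  refine ⟨?_, ?_, newBinaryCode_three_twentyOne, ?_, newBinaryCode_four_thirtyOne⟩
  · intro r hr
    simp only [Finset.mem_insert, Finset.mem_singleton] at hr
    obtain rfl | rfl | rfl := hr
    · exact newBinaryCode_two (m := 6) (by norm_num) (by norm_num) (by norm_num)
    · exact newBinaryCode_two (m := 7) (by norm_num) (by norm_num) (by norm_num)
    · exact newBinaryCode_two (m := 8) (by norm_num) (by norm_num) (by norm_num)
  · intro r hr
    simp only [Finset.mem_insert, Finset.mem_singleton] at hr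
    obtain rfl | rfl := hr
    · exact newBinaryCode_three (m := 4) (by norm_num) (by norm_num) (by norm_num)
    · exact newBinaryCode_three (m := 5) (by norm_num) (by norm_num) (by norm_num)
  · intro r hr
    simp only [Finset.mem_insert, Finset.mem_singleton] at hr
    obtain rfl | rfl | rfl | rfl | rfl := hr
    · exact newBinaryCode_four (m := 7) (by norm_num) (by norm_num) (by norm_num)
    · exact newBinaryCode_four (m := 8) (by norm_num) (by norm_num) (by norm_num)
    · exact newBinaryCode_four (m := 9) (by norm_num) (by norm_num) (by norm_num)
    · exact newBinaryCode_four (m := 10) (by norm_num) (by norm_num) (by norm_num)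
    · exact newBinaryCode_four (m := 11) (by norm_num) (by norm_num) (by norm_num)
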